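/- **Setting.** All Hilbert spaces are complex and separable. A *measurement* over a Hilbert space $\mathcal K$ is a countable indexed family $\langle L_i : i\in I\rangle$ of bounded operators on $\mathcal K$ with $\sum_{i} L_i^\dagger L_i=\mathrm{Id}$ in the weak operator topology; the indices $i$ are its outcomes. A *density operator* is a nonzero positive operator of finite trace (not necessarily normalized); it is *pure* if it has the form $|\psi\rangle\langle\psi|$. If the measurement is performed in state $\tau$, then outcome $i$ has probability $\mathrm{Tr}(L_i\tau L_i^\dagger)/\mathrm{Tr}(\tau)$ and leads to the state $L_i\tau L_i^\dagger$. A *quantum circuit* $C$ consists of finitely many wires $w$, carrying Hilbert spaces $\mathcal K_w$, and finitely many gates; each wire passes through a sequence of distinct gates. Each gate $G$ has a set of classical sources (the gates with a classical channel to $G$), a finite nonempty set of measurements over the tensor product of the spaces of its wires (different measurements of $G$ have disjoint outcome sets), and a selection function $\Sigma_G$ that picks the measurement of $G$ from the outcomes of the classical sources; every measurement of $G$ is in the range of $\Sigma_G$. Unitary gates are measurements with a single outcome. The circuit comes with a schedule: a sequence $(B_1,\dots,B_N)$ of disjoint sets of gates that contain all the gates, such that all (direct or indirect, quantum or classical)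 prerequisites of a gate of $B_n$ are in $\bigcup_{k<n}B_k$. The principal inputs and outputs of $C$ are states in a Hilbert space $\mathcal H$, the ancillas and the garbage live in a Hilbert space $\mathcal A$, and $\mathcal H\otimes\mathcal A$ is identified unitarily with $\bigotimes_w\mathcal K_w$ at the beginning and at the end of the computation. Fix a unit vector $|a\rangle\in\mathcal A$; the full input for the principal input $\rho$ is $\hat\rho=\rho\otimes|a\rangle\langle a|$. A *computation path* $\mu$ assigns to each gate $G$ an outcome $\mu(G)$ of the measurement $\Sigma_G(\mu(F): F \text{ a classical source of } G)$. Along $\mu$, the gates of $B_n$ act together on $\bigotimes_w\mathcal K_w$ by the tensor product of the operators of their outcomes and of the identity on the remaining wires. $\mathrm{Out}_C(\mu\,|\,\hat\rho)$ denotes the (unnormalized) state on $\mathcal H\otimes\mathcal A$ that results from $\hat\rho$ when the operators of $B_1,\dots,B_N$ along $\mu$ are applied one after the other. $P_C(\mu\,|\,\hat\rho)$ is the probability that the computation follows $\mu$: the product over $n$ of the probabilities that $B_n$ produces the outcomes prescribed by $\mu$ in the current state (zero as soon as one of them is zero). **Theorem (Input independence).** Let $C$ be a quantum circuit, $\mu$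 a computation path through $C$ and $U_\mu$ a unitary operator on $\mathcal H$. Say that $C$ computes $U_\mu$ along $\mu$ on $\rho$ if $\mathrm{Tr}_{\mathcal A}\big(\mathrm{Out}_C(\mu\,|\,\hat\rho)\big)$ equals $U_\mu\rho\,U_\mu^\dagger$ up to a scalar factor. 1. If $C$ computes $U_\mu$ along $\mu$ on every density operator $\rho$ on $\mathcal H$, then $P_C(\mu\,|\,\hat\rho)$ does not depend on the density operator $\rho$. 2. For the same conclusion (for all density operators $\rho$, pure or not) it suffices that $C$ computes $U_\mu$ along $\mu$ on every pure $\rho$. -/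

import Mathlib

open scoped ComplexOrder TensorProduct ENNReal InnerProductSpace
open UniformSpace

noncomputable section

namespace QCircuit

/-- The Hilbert tensor product of two Hilbert spaces: the completion of the algebraic tensor
product for the inner product with `⟪x ⊗ y, x' ⊗ y'⟫ = ⟪x, x'⟫ * ⟪y, y'⟫`. -/
abbrev HTensor (E F : Type*) [NormedAddCommGroup E] [InnerProductSpace ℂ E]
    [NormedAddCommGroup F] [InnerProductSpace ℂ F] : Type _ :=
  Completion (E ⊗[ℂ] F)

/-- The vector `x ⊗ y` of the Hilbert tensor product. -/
def htmul {E F : Type*} [NormedAddCommGroup E] [InnerProductSpace ℂ E]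
    [NormedAddCommGroup F] [InnerProductSpace ℂ F] (x : E) (y : F) : HTensor E F :=
  ((x ⊗ₜ[ℂ] y : E ⊗[ℂ] F) : Completion (E ⊗[ℂ] F))

/-- The operator `f ⊗ g` on the Hilbert tensor product. -/
def opTensor {E F : Type*} [NormedAddCommGroup E] [InnerProductSpace ℂ E]
    [NormedAddCommGroup F] [InnerProductSpace ℂ F] (f : E →L[ℂ] E) (g : F →L[ℂ] F) :
    HTensor E F →L[ℂ] HTensor E F :=
  (TensorProduct.mapL f g).completion

section PiTensor

set_option linter.unusedSectionVars false

variable {W : Type*} [Fintype W] (K : W → Type*) [∀ w, NormedAddCommGroup (K w)]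
  [∀ w, InnerProductSpace ℂ (K w)]

/-- The algebraic tensor product of a finite family of inner product spaces, as a type of its own:
it carries the inner product with `⟪⊗ x, ⊗ y⟫ = ∏ w, ⟪x w, y w⟫` (see `inner_pureTensor`). -/
def AlgTensor (K : W → Type*) [∀ w, NormedAddCommGroup (K w)]
  [∀ w, InnerProductSpace ℂ (K w)] : Type _ := ⨂[ℂ] w, K w

instance : AddCommGroup (AlgTensor K) := inferInstanceAs (AddCommGroup (⨂[ℂ] w, K w))
instance : Module ℂ (AlgTensor K) := inferInstanceAs (Module ℂ (⨂[ℂ] w, K w))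

/-- The product vector `⊗_w x w`. -/
def pureTensor : MultilinearMap ℂ K (AlgTensor K) := PiTensorProduct.tprod ℂ

variable {K}

theorem exists_repr (T : AlgTensor K) :
    ∃ c : (Π w, K w) →₀ ℂ, c.sum (fun x a => a • pureTensor K x) = T := by
  have : T ∈ Submodule.span ℂ (Set.range (PiTensorProduct.tprod ℂ (s := K))) := by
    rw [PiTensorProduct.span_tprod_eq_top]; trivial
  exact Finsupp.mem_span_range_iff_exists_finsupp.1 this

theorem alg_ext {F : Type*} [AddCommMonoid F] [Module ℂ F] {f g : AlgTensor K →ₗ[ℂ] F}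
    (h : ∀ x, f (pureTensor K x) = g (pureTensor K x)) : f = g :=
  PiTensorProduct.ext (MultilinearMap.ext h)

/-- For fixed `x`, the linear functional `⊗ y ↦ ∏ w, ⟪x w, y w⟫`. -/
def rowMap (x : Π w, K w) : AlgTensor K →ₗ[ℂ] ℂ :=
  PiTensorProduct.lift ((MultilinearMap.mkPiAlgebra ℂ W ℂ).compLinearMap
    fun w => (innerSL ℂ (x w)).toLinearMap)

theorem rowMap_pureTensor (x y : Π w, K w) : rowMap x (pureTensor K y) = ∏ w, ⟪x w, y w⟫_ℂ :=
  (PiTensorProduct.lift.tprod y).trans (by simp)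

theorem rowMap_update_add [DecidableEq W] (m : Π w, K w) (i : W) (x y : K i) :
    rowMap (Function.update m i (x + y)) =
      rowMap (Function.update m i x) + rowMap (Function.update m i y) := by
  refine alg_ext fun z => ?_
  simp only [LinearMap.add_apply, rowMap_pureTensor]
  simp only [← Finset.mul_prod_erase Finset.univ _ (Finset.mem_univ i), Function.update_self,
    inner_add_left, add_mul]
  congr 1 <;> congr 1 <;> refine Finset.prod_congr rfl fun w hw => ?_ <;>
    rw [Function.update_of_ne (Finset.ne_of_mem_erase hw),
      Function.update_of_ne (Finset.ne_of_mem_erase hw)]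

theorem rowMap_update_smul [DecidableEq W] (m : Π w, K w) (i : W) (c : ℂ) (x : K i) :
    rowMap (Function.update m i (c • x)) = star c • rowMap (Function.update m i x) := by
  refine alg_ext fun z => ?_
  simp only [LinearMap.smul_apply, rowMap_pureTensor]
  simp only [← Finset.mul_prod_erase Finset.univ _ (Finset.mem_univ i), Function.update_self,
    inner_smul_left, smul_eq_mul, mul_assoc]
  congr 2
  refine Finset.prod_congr rfl fun w hw => ?_
  rw [Function.update_of_ne (Finset.ne_of_mem_erase hw),
      Function.update_of_ne (Finset.ne_of_mem_erase hw)]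

/-- For fixed `T`, the linear functional `⊗ x ↦ conj ⟪⊗ x, T⟫`. -/
def colMap (T : AlgTensor K) : AlgTensor K →ₗ[ℂ] ℂ :=
  PiTensorProduct.lift
    { toFun := fun x => star (rowMap x T)
      map_update_add' := fun m i x y => by simp [rowMap_update_add]
      map_update_smul' := fun m i c x => by simp [rowMap_update_smul] }

theorem colMap_pureTensor (T : AlgTensor K) (x : Π w, K w) : colMap T (pureTensor K x) = star (rowMap x T) :=
  PiTensorProduct.lift.tprod x

instance : Inner ℂ (AlgTensor K) := ⟨fun S T => star (colMap T S)⟩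

theorem inner_def (S T : AlgTensor K) : ⟪S, T⟫_ℂ = star (colMap T S) := rfl

theorem inner_pureTensor (x y : Π w, K w) : ⟪pureTensor K x, pureTensor K y⟫_ℂ = ∏ w, ⟪x w, y w⟫_ℂ := by
  simp [inner_def, colMap_pureTensor, rowMap_pureTensor]

theorem colMap_add (S T : AlgTensor K) : colMap (S + T) = colMap S + colMap T :=
  alg_ext fun x => by simp [colMap_pureTensor]

theorem colMap_smul (c : ℂ) (T : AlgTensor K) : colMap (c • T) = star c • colMap T :=
  alg_ext fun x => by simp [colMap_pureTensor]

/-- `colMap` depends conjugate-linearly on `T`. -/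
def colMapₛₗ : AlgTensor K →ₗ⋆[ℂ] AlgTensor K →ₗ[ℂ] ℂ where
  toFun := colMap
  map_add' := colMap_add
  map_smul' := colMap_smul

theorem inner_sum_sum (c d : (Π w, K w) →₀ ℂ) :
    ⟪c.sum (fun x a => a • pureTensor K x), d.sum (fun x a => a • pureTensor K x)⟫_ℂ =
      ∑ x ∈ c.support, ∑ y ∈ d.support, star (c x) * (d y) * ∏ w, ⟪x w, y w⟫_ℂ := by
  rw [inner_def]
  change star (colMapₛₗ _ _) = _
  simp only [Finsupp.sum, map_sum, LinearMap.sum_apply, star_sum, map_smul, LinearMap.map_smulₛₗ]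
  refine Finset.sum_congr rfl fun x _ => ?_
  rw [Finset.smul_sum, star_sum]
  refine Finset.sum_congr rfl fun y _ => ?_
  change star ((c x) • (star (d y) • colMap (pureTensor K y) (pureTensor K x))) = _
  simp [colMap_pureTensor, rowMap_pureTensor]
  ring

theorem posSemidef_prod (v : Finset (Π w, K w)) (s : Finset W) :
    (Matrix.of fun x y : v => ∏ w ∈ s, ⟪x.1 w, y.1 w⟫_ℂ).PosSemidef := by
  classical
  induction s using Finset.induction_on with
  | empty =>
    have h : (Matrix.of fun x y : v => ∏ w ∈ (∅ : Finset W), ⟪x.1 w, y.1 w⟫_ℂ) =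
        Matrix.gram ℂ (fun _ : v => (1 : ℂ)) := by
      ext x y
      simp [Matrix.gram]
    rw [h]
    exact Matrix.posSemidef_gram ℂ _
  | insert w s hw ih =>
    have h : (Matrix.of fun x y : v => ∏ w ∈ insert w s, ⟪x.1 w, y.1 w⟫_ℂ) =
        (Matrix.gram ℂ (fun x : v => x.1 w)).hadamard
          (Matrix.of fun x y : v => ∏ w ∈ s, ⟪x.1 w, y.1 w⟫_ℂ) := by
      ext x y
      simp [Finset.prod_insert hw, Matrix.gram]
    rw [h]
    exact (Matrix.posSemidef_gram ℂ (fun x : v => x.1 w)).hadamard ih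

instance core : PreInnerProductSpace.Core ℂ (AlgTensor K) where
  conj_inner_symm S T := by
    obtain ⟨c, rfl⟩ := exists_repr S
    obtain ⟨d, rfl⟩ := exists_repr T
    rw [inner_sum_sum, inner_sum_sum, Finset.sum_comm]
    simp only [map_sum, map_mul, map_prod, inner_conj_symm]
    refine Finset.sum_congr rfl fun x _ => Finset.sum_congr rfl fun y _ => ?_
    rw [starRingEnd_apply, star_star, mul_comm (d y)]
    rfl
  re_inner_nonneg S := by
    obtain ⟨c, rfl⟩ := exists_repr S
    have h := (posSemidef_prod c.support Finset.univ).dotProduct_mulVec_nonneg (fun x => c x.1)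
    have h2 := (Complex.nonneg_iff.1 h).1
    rw [inner_sum_sum]
    convert h2 using 1
    simp only [dotProduct, Matrix.mulVec, Matrix.of_apply, Finset.mul_sum]
    rw [← Finset.sum_coe_sort c.support]
    simp only [← Finset.sum_coe_sort c.support]
    change Complex.re _ = _
    congr 1
    refine Finset.sum_congr rfl fun x _ => Finset.sum_congr rfl fun y _ => ?_
    simp
    ring
  add_left S T R := by simp [inner_def]
  smul_left S T c := by simp [inner_def]

instance : SeminormedAddCommGroup (AlgTensor K) :=
  InnerProductSpace.Core.toSeminormedAddCommGroup (𝕜 := ℂ)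

instance : InnerProductSpace ℂ (AlgTensor K) := InnerProductSpace.ofCore core

variable (K) in
/-- The Hilbert tensor product `⊗_w K w` of a finite family of Hilbert spaces: the (Hausdorff)
completion of the algebraic tensor product. -/
abbrev PiHTensor : Type _ := Completion (AlgTensor K)

theorem inner_coe_pureTensor (x y : Π w, K w) :
    ⟪((pureTensor K x : AlgTensor K) : PiHTensor K), ((pureTensor K y : AlgTensor K) : PiHTensor K)⟫_ℂ =
      ∏ w, ⟪x w, y w⟫_ℂ := by
  rw [Completion.inner_coe, inner_pureTensor]

theorem norm_of_inner_pureTensor {E : Type*} [NormedAddCommGroup E] [InnerProductSpace ℂ E]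
    (f : AlgTensor K →ₗ[ℂ] E)
    (h : ∀ x y, ⟪f (pureTensor K x), f (pureTensor K y)⟫_ℂ = ∏ w, ⟪x w, y w⟫_ℂ) (T : AlgTensor K) :
    ‖f T‖ = ‖T‖ := by
  have : ⟪f T, f T⟫_ℂ = ⟪T, T⟫_ℂ := by
    obtain ⟨c, rfl⟩ := exists_repr T
    simp only [Finsupp.sum, map_sum, map_smul, sum_inner, inner_sum, inner_smul_left,
      inner_smul_right, h, inner_pureTensor]
  rw [@norm_eq_sqrt_re_inner ℂ, @norm_eq_sqrt_re_inner ℂ, this]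

variable [DecidableEq W] (S : Finset W)

variable (K) in
/-- The tensor product of the spaces of the wires in `S`. -/
abbrev Inside : Type _ := PiHTensor fun w : {w // w ∈ S} => K w

variable (K) in
/-- The tensor product of the spaces of the wires outside `S`. -/
abbrev Outside : Type _ := PiHTensor fun w : {w // w ∉ S} => K w

/-- The part of the product vector `⊗_w x w` on the wires in `S`. -/
def inPart (x : Π w, K w) : Inside K S :=
  ((pureTensor (fun w : {w // w ∈ S} => K w) fun w => x w : AlgTensor _) : Completion (AlgTensor _))

/-- The part of the product vector `⊗_w x w` on the wires outside `S`. -/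
def outPart (x : Π w, K w) : Outside K S :=
  ((pureTensor (fun w : {w // w ∉ S} => K w) fun w => x w : AlgTensor _) : Completion (AlgTensor _))

theorem restrict_update_mem {p : W → Prop} (m : Π w, K w) (i : W) (hi : p i) (x : K i)
    [DecidableEq {w // p w}] :
    (fun w : {w // p w} => Function.update m i x w) =
      Function.update (fun w : {w // p w} => m w) ⟨i, hi⟩ x := by
  funext w
  obtain ⟨w, hw⟩ := w
  by_cases h : w = i
  · subst h; simp
  · rw [Function.update_of_ne h, Function.update_of_ne (by simpa using h)]

theorem restrict_update_not_mem {p : W → Prop} (m : Π w, K w) (i : W) (hi : ¬ p i) (x : K i) :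
    (fun w : {w // p w} => Function.update m i x w) = (fun w : {w // p w} => m w) := by
  funext w
  obtain ⟨w, hw⟩ := w
  rw [Function.update_of_ne]
  rintro rfl
  exact hi hw

/-- The isometric linear map `⊗_w x w ↦ (⊗_{w ∈ S} x w) ⊗ (⊗_{w ∉ S} x w)`. -/
def splitMap : AlgTensor K →ₗ[ℂ] HTensor (Inside K S) (Outside K S) :=
  PiTensorProduct.lift (MultilinearMap.mk' (fun x => htmul (inPart S x) (outPart S x))
    (fun m i x y => by
      by_cases hi : i ∈ S
      · simp only [htmul, inPart, outPart]
        simp only [restrict_update_mem (p := (· ∈ S)) m i hi,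
          restrict_update_not_mem (p := (· ∉ S)) m i (not_not.2 hi), MultilinearMap.map_update_add,
          Completion.coe_add, TensorProduct.add_tmul]
      · simp only [htmul, inPart, outPart]
        simp only [restrict_update_mem (p := (· ∉ S)) m i hi,
          restrict_update_not_mem (p := (· ∈ S)) m i hi, MultilinearMap.map_update_add,
          Completion.coe_add, TensorProduct.tmul_add])
    (fun m i c x => by
      by_cases hi : i ∈ S
      · simp only [htmul, inPart, outPart]
        simp only [restrict_update_mem (p := (· ∈ S)) m i hi,
          restrict_update_not_mem (p := (· ∉ S)) m i (not_not.2 hi), MultilinearMap.map_update_smul,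
          Completion.coe_smul, ← TensorProduct.smul_tmul']
      · simp only [htmul, inPart, outPart]
        simp only [restrict_update_mem (p := (· ∉ S)) m i hi,
          restrict_update_not_mem (p := (· ∈ S)) m i hi, MultilinearMap.map_update_smul,
          Completion.coe_smul, TensorProduct.tmul_smul]))

theorem splitMap_pureTensor (x : Π w, K w) :
    splitMap S (pureTensor K x) = htmul (inPart S x) (outPart S x) :=
  PiTensorProduct.lift.tprod x

theorem norm_splitMap (T : AlgTensor K) : ‖splitMap S T‖ = ‖T‖ := by
  refine norm_of_inner_pureTensor _ (fun x y => ?_) T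
  rw [splitMap_pureTensor, splitMap_pureTensor, htmul, htmul, Completion.inner_coe, TensorProduct.inner_tmul,
    inPart, inPart, outPart, outPart, inner_coe_pureTensor, inner_coe_pureTensor]
  convert Fintype.prod_subtype_mul_prod_subtype (· ∈ S) fun w => ⟪x w, y w⟫_ℂ using 2
  exact Finset.prod_congr (by ext; simp) fun _ _ => rfl

theorem dense_pureTensor {V : Type*} [Fintype V] (L : V → Type*) [∀ w, NormedAddCommGroup (L w)]
    [∀ w, InnerProductSpace ℂ (L w)] :
    Dense (Submodule.span ℂ (Set.range fun x : Π w, L w =>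
      ((pureTensor L x : AlgTensor L) : PiHTensor L)) : Set (PiHTensor L)) := by
  have h : (Submodule.span ℂ (Set.range fun x : Π w, L w =>
      ((pureTensor L x : AlgTensor L) : PiHTensor L)) : Set (PiHTensor L)) =
      Set.range ((↑) : AlgTensor L → Completion (AlgTensor L)) := by
    have h1 : Submodule.span ℂ (Set.range (pureTensor L)) = ⊤ := PiTensorProduct.span_tprod_eq_top
    have h2 : (Set.range fun x : Π w, L w => ((pureTensor L x : AlgTensor L) : PiHTensor L)) =
      (Completion.toComplL (𝕜 := ℂ) (E := AlgTensor L)).toLinearMap '' Set.range (pureTensor L) := by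
      rw [← Set.range_comp]; rfl
    rw [h2, Submodule.span_image, h1]
    ext z; simp
  rw [h]
  exact Completion.denseRange_coe

theorem denseRange_splitMap : DenseRange (splitMap (K := K) S) := by
  set R : Submodule ℂ (HTensor (Inside K S) (Outside K S)) :=
    (LinearMap.range (splitMap (K := K) S)).topologicalClosure with hR
  have hcl : IsClosed (R : Set (HTensor (Inside K S) (Outside K S))) := Submodule.isClosed_topologicalClosure _
  have hcont : Continuous fun p : Inside K S × Outside K S => htmul p.1 p.2 :=
    (Completion.continuous_coe _).comp (TensorProduct.continuous_tmul)
  have h0 : ∀ x y, htmul (((pureTensor (fun w : {w // w ∈ S} => K w) x : AlgTensor _)) : Inside K S)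
      (((pureTensor (fun w : {w // w ∉ S} => K w) y : AlgTensor _)) : Outside K S) ∈ R := by
    intro x y
    refine Submodule.le_topologicalClosure _ ⟨pureTensor K fun w =>
      if h : w ∈ S then x ⟨w, h⟩ else y ⟨w, h⟩, ?_⟩
    rw [splitMap_pureTensor, inPart, outPart]
    congr 3
    · funext w; simp [w.2]
    · funext w; simp [w.2]
  have h1 : ∀ (a : Inside K S) y,
      htmul a (((pureTensor (fun w : {w // w ∉ S} => K w) y : AlgTensor _)) : Outside K S) ∈ R := by
    intro a y
    refine (dense_pureTensor (fun w : {w // w ∈ S} => K w)).induction (fun a ha => ?_)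
      (hcl.preimage (hcont.comp (Continuous.prodMk continuous_id continuous_const))) a
    induction ha using Submodule.span_induction with
    | mem a ha => obtain ⟨x, rfl⟩ := ha; exact h0 x y
    | zero =>
      rw [htmul, TensorProduct.zero_tmul, Completion.coe_zero]
      exact R.zero_mem
    | add a b _ _ ha hb =>
      have := R.add_mem ha hb
      simpa only [htmul, TensorProduct.add_tmul, Completion.coe_add] using this
    | smul c a _ ha =>
      have := R.smul_mem c ha
      simpa only [htmul, ← TensorProduct.smul_tmul', Completion.coe_smul] using this
  have h2 : ∀ (a : Inside K S) (b : Outside K S), htmul a b ∈ R := by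
    intro a b
    refine (dense_pureTensor (fun w : {w // w ∉ S} => K w)).induction (fun b hb => ?_)
      (hcl.preimage (hcont.comp (Continuous.prodMk continuous_const continuous_id))) b
    induction hb using Submodule.span_induction with
    | mem b hb => obtain ⟨y, rfl⟩ := hb; exact h1 a y
    | zero =>
      rw [htmul, TensorProduct.tmul_zero, Completion.coe_zero]
      exact R.zero_mem
    | add b c _ _ hb hc =>
      have := R.add_mem hb hc
      simpa only [htmul, TensorProduct.tmul_add, Completion.coe_add] using this
    | smul c b _ hb =>
      have := R.smul_mem c hb
      simpa only [htmul, TensorProduct.tmul_smul, Completion.coe_smul] using this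
  have h3 : ∀ z, z ∈ R := by
    intro z
    refine Completion.induction_on z hcl fun t => ?_
    induction t using TensorProduct.induction_on with
    | zero => rw [Completion.coe_zero]; exact R.zero_mem
    | tmul a b => exact h2 a b
    | add s t hs ht => rw [Completion.coe_add]; exact R.add_mem hs ht
  intro z
  exact h3 z

/-- The canonical unitary `(⊗_{w ∈ S} K w) ⊗ (⊗_{w ∉ S} K w) ≃ ⊗_w K w`; it is determined by its
values on product vectors, see `cut_htmul`. -/
def cut : HTensor (Inside K S) (Outside K S) ≃ₗᵢ[ℂ] PiHTensor K :=
  (LinearEquiv.refl ℂ (AlgTensor K)).extendOfIsometry (splitMap S)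
    (Completion.toComplL (𝕜 := ℂ) (E := AlgTensor K)).toLinearMap
    (denseRange_splitMap S) Completion.denseRange_coe
    (fun T => by simp [norm_splitMap])

theorem cut_htmul (x : Π w, K w) :
    cut S (htmul (inPart S x) (outPart S x)) = ((pureTensor K x : AlgTensor K) : PiHTensor K) := by
  rw [← splitMap_pureTensor]
  exact LinearEquiv.extendOfIsometry_eq _ _ _ _ _ _ _

variable {S} in
/-- The operator `L ⊗ Id` on `⊗_w K w`, for an operator `L` on the wires in `S`. -/
def amplify (L : Inside K S →L[ℂ] Inside K S) : PiHTensor K →L[ℂ] PiHTensor K :=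
  (cut (K := K) S : HTensor (Inside K S) (Outside K S) →L[ℂ] PiHTensor K) ∘L
    opTensor L (ContinuousLinearMap.id ℂ (Outside K S)) ∘L
      ((cut (K := K) S).symm : PiHTensor K →L[ℂ] HTensor (Inside K S) (Outside K S))

end PiTensor

section Operators

variable {E F : Type*} [NormedAddCommGroup E] [InnerProductSpace ℂ E] [CompleteSpace E]
  [NormedAddCommGroup F] [InnerProductSpace ℂ F] [CompleteSpace F]

variable (E) in
/-- The index set of a fixed Hilbert basis (complete orthonormal family) of `E`. -/
def basisSet : Set E := (exists_hilbertBasis ℂ E).choose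

variable (E) in
/-- A fixed Hilbert basis of `E`. -/
def stdBasis : HilbertBasis (basisSet E) ℂ E := (exists_hilbertBasis ℂ E).choose_spec.choose

/-- The trace of a positive operator, as an extended nonnegative number. For positive operators it
does not depend on the Hilbert basis. -/
def trace (T : E →L[ℂ] E) : ℝ≥0∞ :=
  ∑' i, ENNReal.ofReal (RCLike.re ⟪stdBasis E i, T (stdBasis E i)⟫_ℂ)

/-- Density operators, not necessarily normalized: nonzero positive (semidefinite, Hermitian)
operators of finite trace. -/
structure IsDensityOp (ρ : E →L[ℂ] E) : Prop where
  ne_zero : ρ ≠ 0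
  isPositive : ρ.IsPositive
  trace_ne_top : trace ρ ≠ ⊤

/-- The operator `|ψ⟩⟨ψ|`. -/
def ketbra (ψ : E) : E →L[ℂ] E := InnerProductSpace.rankOne ℂ ψ ψ

/-- Pure states: the density operators of the form `|ψ⟩⟨ψ|`. -/
def IsPureState (ρ : E →L[ℂ] E) : Prop := IsDensityOp ρ ∧ ∃ ψ : E, ρ = ketbra ψ

/-- The operator `L σ L†`. -/
def sandwich (L : E →L[ℂ] F) (σ : E →L[ℂ] E) : F →L[ℂ] F :=
  L ∘L σ ∘L ContinuousLinearMap.adjoint L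

/-- `S` is the partial trace `Tr_F T` of the operator `T` on `E ⊗ F`: for all `x, y` in `E`,
`⟪x, S y⟫ = ∑ j, ⟪x ⊗ e j, T (y ⊗ e j)⟫`, where `e` is a Hilbert basis of `F`. Such an `S` is unique,
and for a positive `T` of finite trace it exists and does not depend on the basis. -/
def IsPartialTrace (T : HTensor E F →L[ℂ] HTensor E F) (S : E →L[ℂ] E) : Prop :=
  ∀ x y : E, HasSum
    (fun j => ⟪htmul x (stdBasis F j : F), T (htmul y (stdBasis F j : F))⟫_ℂ) ⟪x, S y⟫_ℂ

/-- A (general) measurement over `E` with set of outcomes `I`: bounded operators `op i` such that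
`∑ i, (op i)† (op i) = Id` in the weak operator topology. -/
structure Measurement (I : Type*) (E : Type*) [NormedAddCommGroup E] [InnerProductSpace ℂ E]
    [CompleteSpace E] where
  /-- The operator of an outcome. -/
  op : I → E →L[ℂ] E
  hasSum_one : HasSum
    (fun i => (ContinuousLinearMapWOT.ofCLM
      (ContinuousLinearMap.adjoint (op i) ∘L op i) : E →WOT[ℂ] E))
    (ContinuousLinearMapWOT.ofCLM (ContinuousLinearMap.id ℂ E))

end Operators

/-- `F` is an immediate quantum source of `G`: some wire leads from `F` directly to `G`. -/
def QuantumSource {W Gate : Type*} (line : W → List Gate) (F G : Gate) : Prop :=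
  ∃ w, [F, G] <:+: line w

/-- `F` is a (quantum or classical) prerequisite of `G`. -/
def Prerequisite {W Gate : Type*} (line : W → List Gate) (src : Gate → Finset Gate) :
    Gate → Gate → Prop :=
  Relation.TransGen fun F G => QuantumSource line F G ∨ F ∈ src G

/-- The set of the wires that pass through the gate `G`. -/
def gateWires {W Gate : Type*} [Fintype W] [DecidableEq Gate] (line : W → List Gate) (G : Gate) :
    Finset W :=
  Finset.univ.filter fun w => G ∈ line w

universe u₁ u₂

/-- Quantum circuits with measurements (unitary gates being measurements with one outcome),
classical channels and a fixed execution schedule. The wire `w` carries states in the Hilbert space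
`K w`; principal inputs and outputs live in `H`, ancillas and garbage in `A`. -/
structure Circuit (H A : Type*)
    [NormedAddCommGroup H] [InnerProductSpace ℂ H] [CompleteSpace H]
    [TopologicalSpace.SeparableSpace H]
    [NormedAddCommGroup A] [InnerProductSpace ℂ A] [CompleteSpace A]
    [TopologicalSpace.SeparableSpace A]
    {W : Type*} [Fintype W] [DecidableEq W] (K : W → Type*)
    [∀ w, NormedAddCommGroup (K w)] [∀ w, InnerProductSpace ℂ (K w)] [∀ w, CompleteSpace (K w)]
    [∀ w, TopologicalSpace.SeparableSpace (K w)]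
    (Gate : Type*) [Fintype Gate] [LinearOrder Gate] where
  /-- The gates that the wire passes through, from the input to the output. -/
  line : W → List Gate
  line_nodup : ∀ w, (line w).Nodup
  /-- The classical sources: the gates with a classical channel to the given gate. -/
  src : Gate → Finset Gate
  /-- The (names of the) measurements assigned to a gate: a finite nonempty set. -/
  Meas : Gate → Type u₁
  finite_meas : ∀ G, Finite (Meas G)
  nonempty_meas : ∀ G, Nonempty (Meas G)
  /-- The outcomes of a measurement: a countable set. An outcome of a gate is a pair consisting of
  one of its measurements and an outcome of that measurement, so that different measurements of
  the gate have disjoint outcome sets. -/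
  Outcome : (G : Gate) → Meas G → Type u₂
  countable_outcome : ∀ G m, Countable (Outcome G m)
  /-- The measurements of a gate, over the tensor product of the spaces of its wires. -/
  meas : ∀ G m, Measurement (Outcome G m) (Inside K (gateWires line G))
  /-- The selection functions: they pick the measurement to be executed, given the outcomes
  of the classical sources. -/
  select : (G : Gate) → ((F : {F // F ∈ src G}) → (m : Meas F) × Outcome F m) → Meas G
  select_surjective : ∀ G, Function.Surjective (select G)
  /-- The number of bouts of the schedule. -/
  N : ℕ
  /-- The schedule: the set of the gates fired at each step. -/
  bout : Fin N → Finset Gate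
  bout_disjoint : Pairwise fun k n => Disjoint (bout k) (bout n)
  bout_cover : ∀ G, ∃ n, G ∈ bout n
  bout_prerequisite : ∀ n, ∀ G ∈ bout n, ∀ F, Prerequisite line src F G → ∃ k < n, F ∈ bout k
  /-- How the principal input and the ancillas are laid out on the wires at the beginning. -/
  inp : HTensor H A ≃ₗᵢ[ℂ] PiHTensor K
  /-- How the principal output and the garbage are laid out on the wires at the end. -/
  out : HTensor H A ≃ₗᵢ[ℂ] PiHTensor K

namespace Circuit

variable {H A : Type*}
  [NormedAddCommGroup H] [InnerProductSpace ℂ H] [CompleteSpace H]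
  [TopologicalSpace.SeparableSpace H]
  [NormedAddCommGroup A] [InnerProductSpace ℂ A] [CompleteSpace A]
  [TopologicalSpace.SeparableSpace A]
  {W : Type*} [Fintype W] [DecidableEq W] {K : W → Type*}
  [∀ w, NormedAddCommGroup (K w)] [∀ w, InnerProductSpace ℂ (K w)] [∀ w, CompleteSpace (K w)]
  [∀ w, TopologicalSpace.SeparableSpace (K w)]
  {Gate : Type*} [Fintype Gate] [LinearOrder Gate]

/-- A computation path: an outcome for each gate, coherent with the selection functions. -/
structure Path (C : Circuit.{u₁, u₂} H A K Gate) where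
  /-- The outcome of a gate. -/
  outcome : (G : Gate) → (m : C.Meas G) × C.Outcome G m
  coherent : ∀ G, (outcome G).1 = C.select G fun F => outcome F

variable (C : Circuit.{u₁, u₂} H A K Gate) (μ : C.Path)

/-- The operator, on the space of all the wires, of the outcome of `G` along the path. -/
def gateOp (G : Gate) : PiHTensor K →L[ℂ] PiHTensor K :=
  amplify ((C.meas G (μ.outcome G).1).op (μ.outcome G).2)

/-- The operator of the outcomes of the gates of the `n`-th bout along the path: the tensor product
of their operators and of the identity on the remaining wires. It is written as the product of the
`gateOp`s, taken in the fixed order of gates; the gates of a bout have no wires in common, so that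
these factors commute. -/
def boutOp (n : Fin C.N) : PiHTensor K →L[ℂ] PiHTensor K :=
  (((C.bout n).sort (· ≤ ·)).map (C.gateOp μ)).prod

/-- The state, on all the wires, after the first `n` bouts of the computation that follows
the path on full input `σ`. -/
def state (σ : HTensor H A →L[ℂ] HTensor H A) (n : Fin (C.N + 1)) :
    PiHTensor K →L[ℂ] PiHTensor K :=
  Fin.induction (motive := fun _ => PiHTensor K →L[ℂ] PiHTensor K)
    (sandwich (C.inp : HTensor H A →L[ℂ] PiHTensor K) σ)
    (fun n τ => sandwich (C.boutOp μ n) τ) n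

/-- The output of the computation that follows the path on full input `σ`. -/
def output (σ : HTensor H A →L[ℂ] HTensor H A) : HTensor H A →L[ℂ] HTensor H A :=
  sandwich (C.out.symm : PiHTensor K →L[ℂ] HTensor H A) (C.state μ σ (Fin.last C.N))

/-- The probability that the computation follows the path on full input `σ`: the product over the
bouts of the probability `Tr (L τ L†) / Tr τ` that the bout produces, in the current state `τ`,
the outcomes prescribed by the path. If one of the bouts has probability zero, so has the path. -/
def prob (σ : HTensor H A →L[ℂ] HTensor H A) : ℝ≥0∞ :=
  ∏ n : Fin C.N, trace (C.state μ σ n.succ) / trace (C.state μ σ n.castSucc)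

/-- The full input `ρ ⊗ |a⟩⟨a|` for the principal input `ρ` and the initial state `a` of the
ancillas. -/
def fullInput (a : A) (ρ : H →L[ℂ] H) : HTensor H A →L[ℂ] HTensor H A :=
  opTensor ρ (ketbra a)

/-- The circuit, with initial state `a` of the ancillas, computes `U` along the path on principal
input `ρ`: the principal output `Tr_A (output)` agrees with `U ρ U†` up to a scalar factor. -/
def ComputesOn (a : A) (U : H →L[ℂ] H) (ρ : H →L[ℂ] H) : Prop :=
  ∃ S : H →L[ℂ] H, IsPartialTrace (C.output μ (fullInput a ρ)) S ∧
    ∃ c : ℂ, S = c • sandwich U ρ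

end Circuit

end QCircuit

end

/-!
The map `x ↦ x ⊗ a`, the operators along the path `μ` and the unitary layouts of inputs and outputs
compose to one operator `M : H → H ⊗ A` such that the output on `ρ` is `M ρ M†`. The probability of
`μ` is a telescoping product, hence equal to `Tr (M ρ M†) / Tr ρ` (`Circuit.prob_mul_trace`).

If the partial trace of `|M x⟩⟨M x|` is proportional to `|U x⟩⟨U x|`, then `M x` is a product vector
`U x ⊗ b x`. By linearity `b` cannot depend on `x`: slice by slice, for a Hilbert basis `e j` of `A`,
the operator `U† (Id ⊗ ⟨e j|) M` has every vector as an eigenvector, so it is a scalar `c j`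
(`exists_slice_eq_smul`). Therefore `‖M x‖² = R ‖x‖²` with `R = ∑ j, |c j|²`
(`exists_enorm_sq_eq_mul`).

Every positive `ρ` is of the form `T T†`, and `Tr (T T†) = ∑ i, ‖T f i‖²` for a Hilbert basis `f`
(`trace_comp_adjoint`). So `Tr (M ρ M†) = ∑ i, ‖M T f i‖² = R Tr ρ` for pure and mixed states alike,
and the probability is `R`. As the hypothesis was used for pure inputs only, both parts of the theorem
follow.
-/

namespace QCircuit

open ContinuousLinearMap

noncomputable section

/-! ### Traces -/

section Trace

variable {E F G : Type*} [NormedAddCommGroup E] [InnerProductSpace ℂ E]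
  [NormedAddCommGroup F] [InnerProductSpace ℂ F] [CompleteSpace F]
  [NormedAddCommGroup G] [InnerProductSpace ℂ G] [CompleteSpace G]

theorem enorm_sq_eq_ofReal {E : Type*} [NormedAddCommGroup E] (x : E) :
    ‖x‖ₑ ^ 2 = ENNReal.ofReal (‖x‖ ^ 2) := by
  rw [← ofReal_norm, ENNReal.ofReal_pow (norm_nonneg x)]

/-- Parseval's identity in `ℝ≥0∞`. -/
theorem tsum_enorm_inner_sq {ι : Type*} (b : HilbertBasis ι ℂ E) (x : E) :
    ∑' i, ‖⟪b i, x⟫_ℂ‖ₑ ^ 2 = ‖x‖ₑ ^ 2 := by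
  have h := Complex.hasSum_re (b.hasSum_inner_mul_inner x x)
  have h2 : ∀ i, (⟪x, b i⟫_ℂ * ⟪b i, x⟫_ℂ).re = ‖⟪b i, x⟫_ℂ‖ ^ 2 := fun i => by
    rw [← inner_conj_symm x (b i), Complex.conj_mul', ← Complex.ofReal_pow, Complex.ofReal_re]
  simp only [h2] at h
  simp only [enorm_sq_eq_ofReal]
  rw [← ENNReal.ofReal_tsum_of_nonneg (fun _ => by positivity) h.summable, h.tsum_eq]
  congr 1
  exact (norm_sq_eq_re_inner (𝕜 := ℂ) x).symm

theorem eq_zero_of_forall_inner_eq_zero {ι : Type*} (b : HilbertBasis ι ℂ E) {x : E}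
    (h : ∀ i, ⟪b i, x⟫_ℂ = 0) : x = 0 := by
  simpa [h] using (tsum_enorm_inner_sq b x).symm

variable [CompleteSpace E]

/-- The squared Hilbert–Schmidt norm of an operator may be computed from its adjoint, in any
Hilbert bases. -/
theorem tsum_enorm_adjoint_sq {ι κ : Type*} (b : HilbertBasis ι ℂ E) (d : HilbertBasis κ ℂ F)
    (T : E →L[ℂ] F) : ∑' j, ‖adjoint T (d j)‖ₑ ^ 2 = ∑' i, ‖T (b i)‖ₑ ^ 2 := by
  simp only [← tsum_enorm_inner_sq b (adjoint T _), ← tsum_enorm_inner_sq d (T _)]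
  rw [ENNReal.tsum_comm]
  refine tsum_congr fun i => tsum_congr fun j => ?_
  rw [adjoint_inner_right, ← inner_conj_symm, RCLike.enorm_conj]

/-- The trace of `T T†` is the squared Hilbert–Schmidt norm of `T`. -/
theorem trace_comp_adjoint (T : E →L[ℂ] F) :
    trace (T ∘L adjoint T) = ∑' i, ‖T (stdBasis E i)‖ₑ ^ 2 := by
  rw [← tsum_enorm_adjoint_sq (stdBasis E) (stdBasis F), trace]
  refine tsum_congr fun j => ?_
  rw [enorm_sq_eq_ofReal, comp_apply, ← adjoint_inner_left, ← norm_sq_eq_re_inner (𝕜 := ℂ)]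

theorem sandwich_sandwich (L : F →L[ℂ] G) (M : E →L[ℂ] F) (σ : E →L[ℂ] E) :
    sandwich L (sandwich M σ) = sandwich (L ∘L M) σ := by
  simp only [sandwich, adjoint_comp, comp_assoc]

theorem sandwich_comp_adjoint (L : F →L[ℂ] G) (T : E →L[ℂ] F) :
    sandwich L (T ∘L adjoint T) = (L ∘L T) ∘L adjoint (L ∘L T) := by
  simp only [sandwich, adjoint_comp, comp_assoc]

theorem exists_eq_comp_adjoint {τ : E →L[ℂ] E} (hτ : τ.IsPositive) :
    ∃ T : E →L[ℂ] E, τ = T ∘L adjoint T := by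
  obtain ⟨s, rfl⟩ := CStarAlgebra.nonneg_iff_eq_star_mul_self.1 ((nonneg_iff_isPositive τ).2 hτ)
  exact ⟨adjoint s, by rw [adjoint_adjoint]; rfl⟩

theorem isPositive_sandwich {τ : E →L[ℂ] E} (hτ : τ.IsPositive) (L : E →L[ℂ] F) :
    (sandwich L τ).IsPositive := hτ.conj_adjoint L

theorem trace_sandwich_le {τ : E →L[ℂ] E} (hτ : τ.IsPositive) (L : E →L[ℂ] F) :
    trace (sandwich L τ) ≤ ‖L‖ₑ ^ 2 * trace τ := by
  obtain ⟨T, rfl⟩ := exists_eq_comp_adjoint hτ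
  rw [sandwich_comp_adjoint, trace_comp_adjoint, trace_comp_adjoint, ← ENNReal.tsum_mul_left]
  refine ENNReal.tsum_le_tsum fun i => ?_
  rw [← mul_pow]
  gcongr
  exact L.le_opENorm _

/-- If `L` scales all squared norms by `R`, then it scales the traces of states by `R`. -/
theorem trace_sandwich_eq_mul {τ : E →L[ℂ] E} (hτ : τ.IsPositive) {L : E →L[ℂ] F} {R : ℝ≥0∞}
    (hL : ∀ x, ‖L x‖ₑ ^ 2 = R * ‖x‖ₑ ^ 2) : trace (sandwich L τ) = R * trace τ := by
  obtain ⟨T, rfl⟩ := exists_eq_comp_adjoint hτ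
  rw [sandwich_comp_adjoint, trace_comp_adjoint, trace_comp_adjoint, ← ENNReal.tsum_mul_left]
  exact tsum_congr fun i => hL _

theorem eq_zero_of_trace_eq_zero {τ : E →L[ℂ] E} (hτ : τ.IsPositive) (h : trace τ = 0) :
    τ = 0 := by
  obtain ⟨T, rfl⟩ := exists_eq_comp_adjoint hτ
  rw [trace_comp_adjoint] at h
  have h0 : ∀ i, T (stdBasis E i) = 0 := fun i => by
    simpa using ENNReal.tsum_eq_zero.1 h i
  have hT : T = 0 := ext_on
    (Submodule.dense_iff_topologicalClosure_eq_top.2 (stdBasis E).dense_span)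
    (fun x hx => by obtain ⟨i, rfl⟩ := hx; simp [h0])
  simp [hT]

theorem sandwich_ketbra (L : E →L[ℂ] F) (x : E) : sandwich L (ketbra x) = ketbra (L x) := by
  rw [sandwich, ketbra, InnerProductSpace.rankOne_comp, adjoint_adjoint,
    InnerProductSpace.comp_rankOne, ketbra]

theorem isPureState_ketbra {x : E} (hx : x ≠ 0) : IsPureState (ketbra x) := by
  refine ⟨⟨InnerProductSpace.rankOne_ne_zero hx hx, InnerProductSpace.isPositive_rankOne_self x,
    ?_⟩, x, rfl⟩
  have h : trace (ketbra x) = ‖x‖ₑ ^ 2 := by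
    rw [trace, ← tsum_enorm_inner_sq (stdBasis E) x]
    refine tsum_congr fun i => ?_
    rw [enorm_sq_eq_ofReal, ketbra, InnerProductSpace.rankOne_apply, inner_smul_right,
      ← inner_conj_symm x, RCLike.conj_mul]
    norm_cast
  rw [h]
  exact ENNReal.pow_ne_top enorm_ne_top

end Trace

/-! ### Slices of the Hilbert tensor product -/

section Slice

variable {E F : Type*} [NormedAddCommGroup E] [InnerProductSpace ℂ E]
  [NormedAddCommGroup F] [InnerProductSpace ℂ F]

variable (E) in
/-- The operator `x ↦ x ⊗ b`. -/
def tmulRight (b : F) : E →L[ℂ] HTensor E F :=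
  Completion.toComplL ∘L (TensorProduct.mkL ℂ E F).flip b

theorem tmulRight_apply (b : F) (x : E) : tmulRight E b x = htmul x b := rfl

theorem inner_htmul (x x' : E) (y y' : F) :
    ⟪htmul x y, htmul x' y'⟫_ℂ = ⟪x, x'⟫_ℂ * ⟪y, y'⟫_ℂ := by
  rw [htmul, htmul, Completion.inner_coe, TensorProduct.inner_tmul]

theorem enorm_htmul (x : E) (y : F) : ‖htmul x y‖ₑ = ‖x‖ₑ * ‖y‖ₑ := by
  simp [enorm, htmul, ← ENNReal.coe_mul]

theorem dense_span_htmul :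
    Dense (Submodule.span ℂ (Set.range fun p : E × F => htmul p.1 p.2) : Set (HTensor E F)) := by
  refine Completion.denseRange_coe.mono ?_
  rintro _ ⟨t, rfl⟩
  induction t using TensorProduct.induction_on with
  | zero => rw [Completion.coe_zero]; exact Submodule.zero_mem _
  | tmul x y => exact Submodule.subset_span ⟨(x, y), rfl⟩
  | add s t hs ht => rw [Completion.coe_add]; exact Submodule.add_mem _ hs ht

variable [CompleteSpace E]

theorem adjoint_tmulRight_htmul (b : F) (x : E) (y : F) :
    adjoint (tmulRight E b) (htmul x y) = ⟪b, y⟫_ℂ • x := by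
  refine ext_inner_left ℂ fun z => ?_
  rw [adjoint_inner_right, tmulRight_apply, inner_htmul, inner_smul_right, mul_comm]

/-- Adding the ancilla state `b` is conjugation by the operator `x ↦ x ⊗ b`. -/
theorem opTensor_ketbra (b : F) (ρ : E →L[ℂ] E) :
    opTensor ρ (ketbra b) = sandwich (tmulRight E b) ρ := by
  refine ext_on dense_span_htmul ?_
  rintro _ ⟨⟨x, y⟩, rfl⟩
  simp only [sandwich, comp_apply, adjoint_tmulRight_htmul, map_smul, tmulRight_apply]
  simp [htmul, opTensor, ketbra, TensorProduct.tmul_smul]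

variable [CompleteSpace F]

/-- The vectors `e i ⊗ f j` form a Hilbert basis, so that the squared norm of a vector of `E ⊗ F` is
the sum of the squared norms of its slices along a Hilbert basis of `F`. -/
theorem tsum_enorm_slice_sq {ι : Type*} (f : HilbertBasis ι ℂ F) (z : HTensor E F) :
    ∑' j, ‖adjoint (tmulRight E (f j)) z‖ₑ ^ 2 = ‖z‖ₑ ^ 2 := by
  classical
  set v : basisSet E × ι → HTensor E F := fun p => htmul (stdBasis E p.1) (f p.2) with hv
  have hon : Orthonormal ℂ v := by
    have h := orthonormal_iff_ite.1 ((stdBasis E).orthonormal.tmul f.orthonormal)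
    refine orthonormal_iff_ite.2 fun p q => ?_
    rw [← h p q, TensorProduct.inner_tmul]
    exact inner_htmul _ _ _ _
  have hbot : (Submodule.span ℂ (Set.range v))ᗮ = ⊥ := by
    refine (Submodule.eq_bot_iff _).2 fun w hw => ?_
    have h1 : ∀ i j, ⟪htmul (stdBasis E i : E) (f j), w⟫_ℂ = 0 := fun i j =>
      (Submodule.mem_orthogonal _ _).1 hw _ (Submodule.subset_span ⟨(i, j), rfl⟩)
    have h2 : ∀ x j, ⟪htmul x (f j), w⟫_ℂ = 0 := fun x j => by
      have : adjoint (tmulRight E (f j)) w = 0 :=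
        eq_zero_of_forall_inner_eq_zero (stdBasis E) fun i => by
          rw [adjoint_inner_right, tmulRight_apply, h1]
      rw [← tmulRight_apply, ← adjoint_inner_right, this, inner_zero_right]
    have h3 : ∀ x y, ⟪htmul x y, w⟫_ℂ = 0 := fun x y => by
      set T : F →L[ℂ] HTensor E F := Completion.toComplL ∘L TensorProduct.mkL ℂ E F x
      have : adjoint T w = 0 := eq_zero_of_forall_inner_eq_zero f fun j => by
        rw [adjoint_inner_right]
        exact h2 x j
      change ⟪T y, w⟫_ℂ = 0
      rw [← adjoint_inner_right, this, inner_zero_right]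
    refine dense_span_htmul.eq_zero_of_inner_right (𝕜 := ℂ) fun u hu => ?_
    induction hu using Submodule.span_induction with
    | mem u hu => obtain ⟨p, rfl⟩ := hu; exact h3 _ _
    | zero => exact inner_zero_left _
    | add u v _ _ hu hv => rw [inner_add_left, hu, hv, add_zero]
    | smul c u _ hu => rw [inner_smul_left, hu, mul_zero]
  have h := tsum_enorm_inner_sq (HilbertBasis.mkOfOrthogonalEqBot hon hbot) z
  rw [HilbertBasis.coe_mkOfOrthogonalEqBot, ENNReal.tsum_prod', ENNReal.tsum_comm] at h
  rw [← h]
  refine tsum_congr fun j => ?_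
  rw [← tsum_enorm_inner_sq (stdBasis E)]
  simp only [adjoint_inner_right, tmulRight_apply, hv]

/-- If the partial trace of `|M x⟩⟨M x|` is a multiple of `|U x⟩⟨U x|` for all `x`, then each slice of
`M` is a multiple of `U`. For `y ⟂ U x`, the diagonal entry at `y` of the partial trace is a vanishing
sum of squares, so that a slice of `M x` lies in the span of `U x`. Hence each vector is an
eigenvector of `U†` composed with a slice of `M`, which makes that operator a scalar. -/
theorem exists_slice_eq_smul {M : E →L[ℂ] HTensor E F} {U : E →L[ℂ] E}
    (hU : U ∈ unitary (E →L[ℂ] E))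
    (h : ∀ x ≠ 0, ∃ S : E →L[ℂ] E, IsPartialTrace (sandwich M (ketbra x)) S ∧
      ∃ c : ℂ, S = c • sandwich U (ketbra x)) (j : basisSet F) :
    ∃ c : ℂ, ∀ x, adjoint (tmulRight E (stdBasis F j)) (M x) = c • U x := by
  set f : E →L[ℂ] E := adjoint (tmulRight E (stdBasis F j)) ∘L M with hf
  have key : ∀ x, f x ∈ Submodule.span ℂ {U x} := by
    intro x
    rcases eq_or_ne x 0 with rfl | hx
    · simp
    obtain ⟨S, hS, c, rfl⟩ := h x hx
    rw [← Submodule.orthogonal_orthogonal (Submodule.span ℂ {U x}), Submodule.mem_orthogonal]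
    intro y hy
    have hy' : ⟪y, U x⟫_ℂ = 0 := by
      rw [Submodule.mem_orthogonal_singleton_iff_inner_left] at hy
      exact hy
    rw [sandwich_ketbra, sandwich_ketbra] at hS
    have h1 := Complex.hasSum_re (hS y y)
    simp only [ketbra, InnerProductSpace.rankOne_apply, inner_smul_right,
      smul_apply, hy', mul_zero, Complex.zero_re] at h1
    have h2 : ∀ z : HTensor E F, (⟪M x, z⟫_ℂ * ⟪z, M x⟫_ℂ).re = ‖⟪z, M x⟫_ℂ‖ ^ 2 := fun z => by
      rw [← inner_conj_symm (M x), Complex.conj_mul', ← Complex.ofReal_pow, Complex.ofReal_re]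
    simp only [h2] at h1
    have h3 := congrFun ((hasSum_zero_iff_of_nonneg fun _ => by positivity).1 h1) j
    rw [hf, comp_apply, adjoint_inner_right, tmulRight_apply]
    simpa using h3
  obtain ⟨c, hc⟩ := LinearMap.exists_eq_smul_id_of_forall_notLinearIndependent
    (f := (adjoint U ∘L f : E →L[ℂ] E).toLinearMap) (fun x => by
      obtain ⟨c, hc⟩ := Submodule.mem_span_singleton.1 (key x)
      rw [LinearIndependent.pair_iff]
      intro h
      have h1 : adjoint U (U x) = x := congr($(hU.1) x)
      have := h c (-1) (by simp [← hc, h1])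
      simp at this)
  refine ⟨c, fun x => ?_⟩
  have h1 := congrArg U (LinearMap.congr_fun hc x)
  have h2 : U (adjoint U (f x)) = f x := congr($(hU.2) (f x))
  exact h2.symm.trans (h1.trans (by simp))

/-- If the partial trace of `|M x⟩⟨M x|` is a multiple of `|U x⟩⟨U x|` for all `x`, then `M` scales all
squared norms by one constant. It is a sum over the slices in `ℝ≥0∞`, so that its finiteness plays
no role. -/
theorem exists_enorm_sq_eq_mul {M : E →L[ℂ] HTensor E F} {U : E →L[ℂ] E}
    (hU : U ∈ unitary (E →L[ℂ] E))
    (h : ∀ x ≠ 0, ∃ S : E →L[ℂ] E, IsPartialTrace (sandwich M (ketbra x)) S ∧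
      ∃ c : ℂ, S = c • sandwich U (ketbra x)) :
    ∃ R : ℝ≥0∞, ∀ x, ‖M x‖ₑ ^ 2 = R * ‖x‖ₑ ^ 2 := by
  choose c hc using exists_slice_eq_smul hU h
  refine ⟨∑' j, ‖c j‖ₑ ^ 2, fun x => ?_⟩
  have hUx : ‖U x‖ₑ = ‖x‖ₑ := by
    rw [enorm_eq_iff_norm_eq]
    exact norm_map_of_mem_unitary hU x
  rw [← tsum_enorm_slice_sq (stdBasis F), ← ENNReal.tsum_mul_right]
  refine tsum_congr fun j => ?_
  rw [hc, enorm_smul, mul_pow, hUx]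

end Slice

/-! ### Telescoping products -/

/-- A telescoping product in `ℝ≥0∞`. The bounds `t (n + 1) ≤ r * t n` keep all terms finite and let
the sequence stay zero once it vanishes, which takes care of the quotients `0 / 0`. -/
theorem prod_div_mul_eq {N : ℕ} (t : Fin (N + 1) → ℝ≥0∞) (h0 : t 0 ≠ ⊤)
    (h : ∀ n : Fin N, ∃ r : ℝ≥0∞, r ≠ ⊤ ∧ t n.succ ≤ r * t n.castSucc) :
    (∏ n : Fin N, t n.succ / t n.castSucc) * t 0 = t (Fin.last N) := by
  have htop : ∀ n, t n ≠ ⊤ := fun n => by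
    induction n using Fin.induction with
    | zero => exact h0
    | succ n ih =>
      obtain ⟨r, hr, hle⟩ := h n
      exact ne_top_of_le_ne_top (ENNReal.mul_ne_top hr ih) hle
  induction N with
  | zero => simp
  | succ N ih =>
    rw [Fin.prod_univ_castSucc, mul_right_comm]
    have := ih (fun n => t n.castSucc) h0 (fun n => h n.castSucc) (fun n => htop _)
    simp only [Fin.succ_castSucc, Fin.castSucc_zero] at this ⊢
    rw [this, Fin.succ_last]
    refine ENNReal.mul_div_cancel' (fun hz => ?_) fun ht => absurd ht (htop _)
    obtain ⟨r, -, hle⟩ := h (Fin.last N)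
    rw [hz, mul_zero, Fin.succ_last] at hle
    exact le_antisymm hle zero_le

/-! ### States and probabilities along a path -/

namespace Circuit

universe u₁ u₂

variable {H A : Type*}
  [NormedAddCommGroup H] [InnerProductSpace ℂ H] [CompleteSpace H]
  [TopologicalSpace.SeparableSpace H]
  [NormedAddCommGroup A] [InnerProductSpace ℂ A] [CompleteSpace A]
  [TopologicalSpace.SeparableSpace A]
  {W : Type*} [Fintype W] [DecidableEq W] {K : W → Type*}
  [∀ w, NormedAddCommGroup (K w)] [∀ w, InnerProductSpace ℂ (K w)] [∀ w, CompleteSpace (K w)]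
  [∀ w, TopologicalSpace.SeparableSpace (K w)]
  {Gate : Type*} [Fintype Gate] [LinearOrder Gate]
  (C : Circuit.{u₁, u₂} H A K Gate) (μ : C.Path)

theorem state_zero (σ : HTensor H A →L[ℂ] HTensor H A) :
    C.state μ σ 0 = sandwich (C.inp : HTensor H A →L[ℂ] PiHTensor K) σ := rfl

theorem state_succ (σ : HTensor H A →L[ℂ] HTensor H A) (n : Fin C.N) :
    C.state μ σ n.succ = sandwich (C.boutOp μ n) (C.state μ σ n.castSucc) :=
  Fin.induction_succ ..

/-- The state after `n` bouts arises from the full input by conjugation with one operator, which does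
not depend on the input. -/
theorem exists_state_eq_sandwich (n : Fin (C.N + 1)) :
    ∃ L : HTensor H A →L[ℂ] PiHTensor K, ∀ σ, C.state μ σ n = sandwich L σ := by
  induction n using Fin.induction with
  | zero => exact ⟨_, fun σ => rfl⟩
  | succ n ih =>
    obtain ⟨L, hL⟩ := ih
    exact ⟨C.boutOp μ n ∘L L, fun σ => by rw [state_succ, hL, sandwich_sandwich]⟩

theorem isPositive_state {σ : HTensor H A →L[ℂ] HTensor H A} (hσ : σ.IsPositive)
    (n : Fin (C.N + 1)) : (C.state μ σ n).IsPositive := by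
  obtain ⟨L, hL⟩ := C.exists_state_eq_sandwich μ n
  rw [hL]
  exact isPositive_sandwich hσ L

theorem trace_state_zero {σ : HTensor H A →L[ℂ] HTensor H A} (hσ : σ.IsPositive) :
    trace (C.state μ σ 0) = trace σ := by
  rw [state_zero, trace_sandwich_eq_mul hσ (R := 1), one_mul]
  intro x
  rw [one_mul]
  congr 1
  rw [enorm_eq_iff_norm_eq]
  exact C.inp.norm_map x

/-- The probability of a path is the ratio of the final trace to the initial one. -/
theorem prob_mul_trace {σ : HTensor H A →L[ℂ] HTensor H A} (hσ : σ.IsPositive)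
    (hσt : trace σ ≠ ⊤) : C.prob μ σ * trace σ = trace (C.state μ σ (Fin.last C.N)) := by
  rw [← C.trace_state_zero μ hσ] at hσt ⊢
  refine prod_div_mul_eq (fun n => trace (C.state μ σ n)) hσt fun n =>
    ⟨‖C.boutOp μ n‖ₑ ^ 2, ENNReal.pow_ne_top enorm_ne_top, ?_⟩
  rw [state_succ]
  exact trace_sandwich_le (C.isPositive_state μ hσ _) _

/-- If a circuit computes `U` along `μ` on all pure inputs, the probability of `μ` is the same for all
density operators: it is the factor `R` by which the path scales the squared norms of the vectors
`x ⊗ a`. -/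
theorem exists_prob_eq {a : A} (ha : ‖a‖ = 1) {U : H →L[ℂ] H} (hU : U ∈ unitary (H →L[ℂ] H))
    (h : ∀ ρ : H →L[ℂ] H, IsPureState ρ → C.ComputesOn μ a U ρ) :
    ∃ R : ℝ≥0∞, ∀ ρ : H →L[ℂ] H, IsDensityOp ρ → C.prob μ (fullInput a ρ) = R := by
  obtain ⟨L, hL⟩ := C.exists_state_eq_sandwich μ (Fin.last C.N)
  obtain ⟨R, hR⟩ := exists_enorm_sq_eq_mul (U := U)
    (M := (C.out.symm : PiHTensor K →L[ℂ] HTensor H A) ∘L L ∘L tmulRight H a) hU fun x hx => by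
      have := h _ (isPureState_ketbra hx)
      rwa [ComputesOn, output, fullInput, opTensor_ketbra, hL, sandwich_sandwich,
        sandwich_sandwich] at this
  have hV : ∀ x, ‖tmulRight H a x‖ₑ ^ 2 = 1 * ‖x‖ₑ ^ 2 := fun x => by
    rw [tmulRight_apply, enorm_htmul, ← ofReal_norm a, ha, ENNReal.ofReal_one, mul_one, one_mul]
  have hLV : ∀ x, ‖(L ∘L tmulRight H a) x‖ₑ ^ 2 = R * ‖x‖ₑ ^ 2 := fun x => by
    rw [← hR]
    congr 1
    rw [enorm_eq_iff_norm_eq]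
    exact (C.out.symm.norm_map _).symm
  refine ⟨R, fun ρ hρ => ?_⟩
  have htr : trace (fullInput a ρ) = trace ρ := by
    rw [fullInput, opTensor_ketbra, trace_sandwich_eq_mul hρ.isPositive hV, one_mul]
  have hpos : (fullInput a ρ).IsPositive := by
    rw [fullInput, opTensor_ketbra]
    exact isPositive_sandwich hρ.isPositive _
  have hP := C.prob_mul_trace μ hpos (htr ▸ hρ.trace_ne_top)
  rw [hL, htr, fullInput, opTensor_ketbra, sandwich_sandwich,
    trace_sandwich_eq_mul hρ.isPositive hLV, ← opTensor_ketbra] at hP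
  exact (ENNReal.mul_left_inj (fun h0 => hρ.ne_zero (eq_zero_of_trace_eq_zero hρ.isPositive h0))
    hρ.trace_ne_top).1 hP

end Circuit

end

end QCircuit

theorem theorem1 {H A : Type*}
    [NormedAddCommGroup H] [InnerProductSpace ℂ H] [CompleteSpace H]
    [TopologicalSpace.SeparableSpace H]
    [NormedAddCommGroup A] [InnerProductSpace ℂ A] [CompleteSpace A]
    [TopologicalSpace.SeparableSpace A]
    {W : Type*} [Fintype W] [DecidableEq W] {K : W → Type*}
    [∀ w, NormedAddCommGroup (K w)] [∀ w, InnerProductSpace ℂ (K w)] [∀ w, CompleteSpace (K w)]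
    [∀ w, TopologicalSpace.SeparableSpace (K w)]
    {Gate : Type*} [Fintype Gate] [LinearOrder Gate]
    (C : QCircuit.Circuit H A K Gate) (μ : C.Path)
    (a : A) (ha : ‖a‖ = 1)
    (U : H →L[ℂ] H) (hU : U ∈ unitary (H →L[ℂ] H)) :
    -- if `C` computes `U` along `μ` on all principal inputs, `P(μ | ρ)` does not depend on `ρ`
    ((∀ ρ : H →L[ℂ] H, QCircuit.IsDensityOp ρ → C.ComputesOn μ a U ρ) →
      ∀ ρ ρ' : H →L[ℂ] H, QCircuit.IsDensityOp ρ → QCircuit.IsDensityOp ρ' →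
        C.prob μ (QCircuit.Circuit.fullInput a ρ) = C.prob μ (QCircuit.Circuit.fullInput a ρ')) ∧
    -- it suffices that `C` computes `U` along `μ` on pure principal inputs
    ((∀ ρ : H →L[ℂ] H, QCircuit.IsPureState ρ → C.ComputesOn μ a U ρ) →
      ∀ ρ ρ' : H →L[ℂ] H, QCircuit.IsDensityOp ρ → QCircuit.IsDensityOp ρ' →
        C.prob μ (QCircuit.Circuit.fullInput a ρ) =
          C.prob μ (QCircuit.Circuit.fullInput a ρ')) := by
  have pure : (∀ ρ : H →L[ℂ] H, QCircuit.IsPureState ρ → C.ComputesOn μ a U ρ) →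
      ∀ ρ ρ' : H →L[ℂ] H, QCircuit.IsDensityOp ρ → QCircuit.IsDensityOp ρ' →
        C.prob μ (QCircuit.Circuit.fullInput a ρ) =
          C.prob μ (QCircuit.Circuit.fullInput a ρ') := fun h ρ ρ' hρ hρ' => by
    obtain ⟨R, hR⟩ := C.exists_prob_eq μ ha hU h
    rw [hR ρ hρ, hR ρ' hρ']
  exact ⟨fun h => pure fun ρ hρ => h ρ hρ.1, pure⟩
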